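/- Let $D$ be an integral domain with quotient field $K$. For a nonzero fractional ideal $I$ of $D$ put $I^{-1}=\{x\in K\mid xI\subseteq D\}$, $I_v=(I^{-1})^{-1}$, and $I_t=\bigcup_H H_v$, where $H$ ranges over the nonzero finitely generated fractional ideals contained in $I$. The domain $D$ is called \emph{$t$-sharp} if, whenever $I,A,B$ are nonzero ideals of $D$ with $I\supseteq AB$, there exist nonzero ideals $H,J$ of $D$ such that $I_t=(HJ)_t$, $H_t\supseteq A$ and $J_t\supseteq B$. A domain $R$ is called \emph{sharp} if, whenever $I,A,B$ are nonzero ideals of $R$ with $I\supseteq AB$, there exist ideals $H\supseteq A$ and $J\supseteq B$ of $R$ such that $I=HJ$. For a polynomial or power series $f$ over $D$ let $c(f)$ be the ideal of $D$ generated by the coefficients of $f$, and put $$N_v=\{f\in D[X]\setminus\{0\}\mid c(f)_v=D\},\qquad N'_v=\{f\in D[[X]]\setminus\{0\}\mid c(f)_v=D\}.$$ Suppose that $D$ is $t$-sharp. Then $N_v$ and $N'_v$ are multiplicative sets (they contain $1$ and are closed under multiplication), and: 1. $D[[X]]_{N'_v}$ is a sharp domain; 2. every ideal of $D[[X]]_{N'_v}$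 is extended from $D$, i.e. is of the form $I\,D[[X]]_{N'_v}$ for some ideal $I$ of $D$; 3. $D[[X]]_{N'_v}$ is a faithfully flat $D[X]_{N_v}$-module (via the homomorphism induced by $D[X]\subseteq D[[X]]$); 4. the extension map $I\mapsto I\,D[[X]]_{N'_v}$ is a bijection from the set of ideals of $D[X]_{N_v}$ to the set of ideals of $D[[X]]_{N'_v}$. -/

import Mathlib

open scoped nonZeroDivisors

noncomputable section

namespace TSharp

/-- The `v`-closure `I_v = (I⁻¹)⁻¹` of a fractional ideal `I` of a domain `D`, where
`I⁻¹ = {x ∈ K | x I ⊆ D}` and `K` is the quotient field. (By Mathlib's convention `1 / 0 = 0`,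
the closure of the zero ideal is zero.) -/
def vClosure {D : Type*} [CommRing D] [IsDomain D]
    (I : FractionalIdeal D⁰ (FractionRing D)) : FractionalIdeal D⁰ (FractionRing D) :=
  1 / (1 / I)

section

variable {D : Type*} [CommRing D] [IsDomain D]

theorem vClosure_mono {I J : FractionalIdeal D⁰ (FractionRing D)} (h : I ≤ J) :
    vClosure I ≤ vClosure J := by
  by_cases hI : I = 0
  · subst hI
    simp [vClosure]
  have hJ : J ≠ 0 := by
    rintro rfl
    exact hI (le_antisymm h zero_le)
  have inv_ne : ∀ L : FractionalIdeal D⁰ (FractionRing D), L ≠ 0 → 1 / L ≠ 0 := by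
    intro L hL h0
    obtain ⟨a, ha, haL⟩ := L.isFractional
    have hmem : algebraMap D (FractionRing D) a ∈
        (1 / L : FractionalIdeal D⁰ (FractionRing D)) := by
      rw [FractionalIdeal.mem_div_iff_of_ne_zero hL]
      intro y hy
      obtain ⟨c, hc⟩ := haL y hy
      rw [FractionalIdeal.mem_one_iff]
      exact ⟨c, by rw [hc, Algebra.smul_def]⟩
    rw [h0, FractionalIdeal.mem_zero_iff] at hmem
    exact nonZeroDivisors.ne_zero ha
      ((map_eq_zero_iff _ (IsFractionRing.injective D (FractionRing D))).1 hmem)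
  have h1 : (1 / J : FractionalIdeal D⁰ (FractionRing D)) ≤ 1 / I := by
    intro x hx
    rw [FractionalIdeal.mem_div_iff_of_ne_zero hJ] at hx
    rw [FractionalIdeal.mem_div_iff_of_ne_zero hI]
    exact fun y hy => hx y (h hy)
  intro x hx
  unfold vClosure at hx ⊢
  rw [FractionalIdeal.mem_div_iff_of_ne_zero (inv_ne I hI)] at hx
  rw [FractionalIdeal.mem_div_iff_of_ne_zero (inv_ne J hJ)]
  exact fun y hy => hx y (h1 hy)

end

/-- The submodule of `K` underlying the `t`-closure of `I`: the union of the `H_v` over the finitely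
generated fractional ideals `H ⊆ I`. (The zero ideal is allowed as `H`; since its `v`-closure is
zero this does not change the union when `I ≠ 0`.) -/
def tClosureSubmodule {D : Type*} [CommRing D] [IsDomain D]
    (I : FractionalIdeal D⁰ (FractionRing D)) : Submodule D (FractionRing D) where
  carrier := {x | ∃ H : FractionalIdeal D⁰ (FractionRing D),
    (H : Submodule D (FractionRing D)).FG ∧ H ≤ I ∧ x ∈ vClosure H}
  zero_mem' := ⟨0, by simpa using Submodule.fg_bot, zero_le, Submodule.zero_mem _⟩
  add_mem' := by
    rintro x y ⟨H, hH, hHI, hx⟩ ⟨L, hL, hLI, hy⟩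
    refine ⟨H ⊔ L, ?_, sup_le hHI hLI, ?_⟩
    · rw [FractionalIdeal.coe_sup]
      exact hH.sup hL
    · exact Submodule.add_mem _ (vClosure_mono le_sup_left hx) (vClosure_mono le_sup_right hy)
  smul_mem' := by
    rintro a x ⟨H, hH, hHI, hx⟩
    exact ⟨H, hH, hHI, Submodule.smul_mem _ a hx⟩

theorem tClosureSubmodule_le {D : Type*} [CommRing D] [IsDomain D]
    (I : FractionalIdeal D⁰ (FractionRing D)) :
    tClosureSubmodule I ≤ (vClosure I : Submodule D (FractionRing D)) := by
  rintro x ⟨H, -, hHI, hx⟩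
  exact vClosure_mono hHI hx

/-- The `t`-closure `I_t = ⋃ H_v` of a fractional ideal `I`, the union being over the finitely
generated fractional ideals `H ⊆ I`. -/
def tClosure {D : Type*} [CommRing D] [IsDomain D]
    (I : FractionalIdeal D⁰ (FractionRing D)) : FractionalIdeal D⁰ (FractionRing D) :=
  ⟨tClosureSubmodule I, FractionalIdeal.isFractional_of_le (tClosureSubmodule_le I)⟩

/-- `D` is `t`-sharp: whenever `I ⊇ A B` for nonzero ideals, there are nonzero ideals `H`, `J`
with `I_t = (H J)_t`, `H_t ⊇ A` and `J_t ⊇ B`. -/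
def IsTSharp (D : Type*) [CommRing D] [IsDomain D] : Prop :=
  ∀ I A B : Ideal D, I ≠ ⊥ → A ≠ ⊥ → B ≠ ⊥ → A * B ≤ I →
    ∃ H J : Ideal D, H ≠ ⊥ ∧ J ≠ ⊥ ∧
      tClosure (I : FractionalIdeal D⁰ (FractionRing D)) =
        tClosure ((H * J : Ideal D) : FractionalIdeal D⁰ (FractionRing D)) ∧
      (A : FractionalIdeal D⁰ (FractionRing D)) ≤ tClosure H ∧
      (B : FractionalIdeal D⁰ (FractionRing D)) ≤ tClosure J

/-- `R` is sharp: whenever `I ⊇ A B` for nonzero ideals, there are ideals `H ⊇ A` and `J ⊇ B`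
with `I = H J`. -/
def IsSharp (R : Type*) [CommRing R] : Prop :=
  ∀ I A B : Ideal R, I ≠ ⊥ → A ≠ ⊥ → B ≠ ⊥ → A * B ≤ I →
    ∃ H J : Ideal R, I = H * J ∧ A ≤ H ∧ B ≤ J

/-- The content of a power series: the ideal generated by its coefficients. -/
def content {D : Type*} [CommRing D] (f : PowerSeries D) : Ideal D :=
  Ideal.span (Set.range fun n : ℕ => PowerSeries.coeff n f)

theorem content_coe {D : Type*} [CommRing D] (p : Polynomial D) :
    content (p : PowerSeries D) = p.contentIdeal := by
  apply le_antisymm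
  · refine Ideal.span_le.2 ?_
    rintro _ ⟨n, rfl⟩
    simpa using p.coeff_mem_contentIdeal n
  · rw [Polynomial.contentIdeal_def]
    refine Ideal.span_mono ?_
    intro a ha
    obtain ⟨n, -, rfl⟩ := Polynomial.mem_coeffs_iff.1 (Finset.mem_coe.1 ha)
    exact ⟨n, by simp⟩

/-- `N_v`: the nonzero polynomials `f` over `D` with `c(f)_v = D`. -/
def Nv (D : Type*) [CommRing D] [IsDomain D] : Set (Polynomial D) :=
  {f | f ≠ 0 ∧ vClosure (f.contentIdeal : FractionalIdeal D⁰ (FractionRing D)) = 1}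

/-- `N'_v`: the nonzero power series `f` over `D` with `c(f)_v = D`. -/
def Nv' (D : Type*) [CommRing D] [IsDomain D] : Set (PowerSeries D) :=
  {f | f ≠ 0 ∧ vClosure (content f : FractionalIdeal D⁰ (FractionRing D)) = 1}

/-- `D[X]_{N_v}`. The localization is at the submonoid generated by `N_v`. -/
abbrev PolyLoc (D : Type*) [CommRing D] [IsDomain D] : Type _ :=
  Localization (Submonoid.closure (Nv D))

/-- `D[[X]]_{N'_v}`. The localization is at the submonoid generated by `N'_v`. -/
abbrev PowerLoc (D : Type*) [CommRing D] [IsDomain D] : Type _ :=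
  Localization (Submonoid.closure (Nv' D))

theorem closure_Nv_le (D : Type*) [CommRing D] [IsDomain D] :
    Submonoid.closure (Nv D) ≤
      (Submonoid.closure (Nv' D)).comap (Polynomial.coeToPowerSeries.ringHom (R := D)) := by
  rw [Submonoid.closure_le]
  rintro p ⟨hp, hc⟩
  refine Submonoid.subset_closure ⟨?_, ?_⟩
  · simpa using hp
  · rw [Polynomial.coeToPowerSeries.ringHom_apply, content_coe]
    exact hc

/-- The canonical ring homomorphism `D[X]_{N_v} → D[[X]]_{N'_v}` induced by `D[X] ⊆ D[[X]]`. -/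
def polyToPower (D : Type*) [CommRing D] [IsDomain D] : PolyLoc D →+* PowerLoc D :=
  IsLocalization.map (PowerLoc D) (Polynomial.coeToPowerSeries.ringHom (R := D))
    (closure_Nv_le D)

end TSharp

end

/-! ### Closures through divisibility -/

namespace TSharp

variable {D : Type*} [CommRing D]

/-! For a nonzero ideal `A` and nonzero `x ∈ A`, apply t-sharpness to `A · xA⁻¹ ⊆ xD`. A finite-type
argument turns the factorization into `HasVInverses`: a finitely generated `Q` with `(QA)_v = xD`.
Everything except sharpness itself uses only this property.

It makes `D` completely integrally closed, hence integrally closed, and yields the content formula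
`c(fg)_v = (c(f)c(g))_v` for power series (`dvd_mul_coeff`). Gauss's lemma may fail for power series
over a valuation ring, so a weighted valuation estimate loses a fixed factor independent of `n`;
complete integral closure absorbs it.

Choosing a polynomial `q` with content `Q`, the formula gives `f * q = x * u` with `u ∈ N'_v`. Hence
each power series equals a polynomial up to `N_v` and `N'_v`, and in both localizations a polynomial
generates the extension of its content. So all ideals come from `D`, and t-closures become
invisible. Thus `D[X]_{N_v}` is Bezout, which gives flatness; faithfulness, the bijection and
sharpness are then read off in `D`. -/

/-- `x` lies in the `v`-closure of the nonzero ideal `I`, expressed through divisibility in `D`. -/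
def VMem (I : Ideal D) (x : D) : Prop :=
  ∀ b c : D, c ≠ 0 → (∀ z ∈ I, c ∣ b * z) → c ∣ b * x

/-- `x` lies in the `t`-closure of the nonzero ideal `I`, expressed through divisibility in `D`. -/
def TMem (I : Ideal D) (x : D) : Prop :=
  ∃ H : Ideal D, H ≤ I ∧ H.FG ∧ H ≠ ⊥ ∧ VMem H x

theorem VMem.mono {I J : Ideal D} (h : I ≤ J) {x : D} (hx : VMem I x) : VMem J x :=
  fun b c hc hz => hx b c hc fun z hzI => hz z (h hzI)

theorem VMem.of_mem {I : Ideal D} {x : D} (hx : x ∈ I) : VMem I x :=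
  fun _ _ _ h => h x hx

theorem TMem.of_mem {I : Ideal D} (hI : I ≠ ⊥) {x : D} (hx : x ∈ I) : TMem I x := by
  obtain ⟨y, hy, hy0⟩ := Submodule.exists_mem_ne_zero_of_ne_bot hI
  -- Since `x` may be zero, a nonzero `y` is adjoined to keep the witness nonzero.
  refine ⟨Ideal.span {x} ⊔ Ideal.span {y}, sup_le ?_ ?_,
    Submodule.FG.sup ⟨{x}, by simp⟩ ⟨{y}, by simp⟩, fun h => hy0 ?_,
    .of_mem (Ideal.mem_sup_left (Ideal.mem_span_singleton_self x))⟩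
  · exact (Ideal.span_singleton_le_iff_mem _).2 hx
  · exact (Ideal.span_singleton_le_iff_mem _).2 hy
  · have := Ideal.mem_sup_right (S := Ideal.span {x}) (Ideal.mem_span_singleton_self y)
    rwa [h, Ideal.mem_bot] at this

theorem TMem.dvd {x y : D} (hx : x ≠ 0) (h : TMem (Ideal.span {x}) y) : x ∣ y := by
  obtain ⟨H, hH, -, -, hv⟩ := h
  simpa using hv 1 x hx fun z hz => by simpa using Ideal.mem_span_singleton.1 (hH hz)

theorem exists_fg_le_mul_of_mem {H J : Ideal D} {e : D} (he : e ∈ H * J) :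
    ∃ J₀ ≤ J, J₀.FG ∧ e ∈ H * J₀ := by
  induction he using Submodule.mul_induction_on' with
  | mem_mul_mem m hm n hn =>
    exact ⟨Ideal.span {n}, (Ideal.span_singleton_le_iff_mem _).2 hn, ⟨{n}, by simp⟩,
      Ideal.mul_mem_mul hm (Ideal.mem_span_singleton_self n)⟩
  | add x _ y _ hx hy =>
    obtain ⟨J₁, h₁, f₁, m₁⟩ := hx
    obtain ⟨J₂, h₂, f₂, m₂⟩ := hy
    exact ⟨J₁ ⊔ J₂, sup_le h₁ h₂, Submodule.FG.sup f₁ f₂,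
      add_mem (Ideal.mul_mono_right le_sup_left m₁) (Ideal.mul_mono_right le_sup_right m₂)⟩

/-- Only the second factor has to shrink: it supplies the finitely generated `Q` of `HasVInverses`.
-/
theorem exists_fg_le_mul_of_fg {H J E : Ideal D} (hE : E.FG) (he : E ≤ H * J) :
    ∃ J₀ ≤ J, J₀.FG ∧ E ≤ H * J₀ := by
  induction E, hE using Submodule.fg_induction with
  | singleton e =>
    obtain ⟨J₀, h, f, m⟩ := exists_fg_le_mul_of_mem (he (Submodule.mem_span_singleton_self e))
    exact ⟨J₀, h, f, by simpa [Submodule.span_le] using m⟩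
  | sup E₁ E₂ _ _ h₁ h₂ =>
    obtain ⟨J₁, h₁, f₁, m₁⟩ := h₁ (le_sup_left.trans he)
    obtain ⟨J₂, h₂, f₂, m₂⟩ := h₂ (le_sup_right.trans he)
    exact ⟨J₁ ⊔ J₂, sup_le h₁ h₂, Submodule.FG.sup f₁ f₂, sup_le (m₁.trans (Ideal.mul_mono_right le_sup_left))
      (m₂.trans (Ideal.mul_mono_right le_sup_right))⟩

variable [IsDomain D]

theorem one_div_coeIdeal_ne_zero {I : Ideal D} :
    (1 / (I : FractionalIdeal D⁰ (FractionRing D))) ≠ 0 ↔ I ≠ ⊥ := by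
  constructor
  · rintro h rfl
    simp at h
  · intro hI h
    have : (1 : FractionRing D) ∈ (1 / (I : FractionalIdeal D⁰ (FractionRing D))) := by
      rw [FractionalIdeal.mem_div_iff_of_ne_zero (FractionalIdeal.coeIdeal_ne_zero.2 hI)]
      intro y hy
      simpa using FractionalIdeal.coeIdeal_le_one hy
    rw [h, FractionalIdeal.mem_zero_iff] at this
    exact one_ne_zero this

theorem div_mul_mem_one_iff {b c z : D} (hc : c ≠ 0) :
    algebraMap D (FractionRing D) b / algebraMap D (FractionRing D) c *
      algebraMap D (FractionRing D) z ∈ (1 : FractionalIdeal D⁰ (FractionRing D)) ↔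
      c ∣ b * z := by
  have hc' : algebraMap D (FractionRing D) c ≠ 0 := by simpa using hc
  rw [FractionalIdeal.mem_one_iff]
  constructor
  · rintro ⟨y, hy⟩
    refine ⟨y, IsFractionRing.injective D (FractionRing D) ?_⟩
    rw [map_mul, map_mul, hy]
    field_simp
  · rintro ⟨y, hy⟩
    refine ⟨y, ?_⟩
    have := congrArg (algebraMap D (FractionRing D)) hy
    rw [map_mul, map_mul] at this
    field_simp
    rw [this, mul_comm]

theorem algebraMap_mem_vClosure_iff {I : Ideal D} (hI : I ≠ ⊥) {x : D} :
    algebraMap D (FractionRing D) x ∈ vClosure (I : FractionalIdeal D⁰ (FractionRing D)) ↔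
      VMem I x := by
  have hI' := FractionalIdeal.coeIdeal_ne_zero (K := FractionRing D).2 hI
  have hI'' : 1 / (I : FractionalIdeal D⁰ (FractionRing D)) ≠ 0 := one_div_coeIdeal_ne_zero.2 hI
  have key : ∀ b c : D, c ≠ 0 → (algebraMap D (FractionRing D) b / algebraMap D (FractionRing D) c ∈
      (1 / (I : FractionalIdeal D⁰ (FractionRing D))) ↔ ∀ z ∈ I, c ∣ b * z) := by
    intro b c hc
    rw [FractionalIdeal.mem_div_iff_of_ne_zero hI']
    constructor
    · exact fun h z hz => (div_mul_mem_one_iff hc).1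
        (h _ ((FractionalIdeal.mem_coeIdeal _).2 ⟨z, hz, rfl⟩))
    · rintro h y hy
      obtain ⟨z, hz, rfl⟩ := (FractionalIdeal.mem_coeIdeal _).1 hy
      exact (div_mul_mem_one_iff hc).2 (h z hz)
  unfold vClosure
  rw [FractionalIdeal.mem_div_iff_of_ne_zero hI'']
  constructor
  · intro h b c hc hz
    rw [← div_mul_mem_one_iff hc, mul_comm]
    exact h _ ((key b c hc).2 hz)
  · intro h y hy
    obtain ⟨b, c, hc, rfl⟩ := IsFractionRing.div_surjective (A := D) y
    have hc0 := nonZeroDivisors.ne_zero hc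
    rw [mul_comm, div_mul_mem_one_iff hc0]
    exact h b c hc0 ((key b c hc0).1 hy)

theorem vClosure_coeIdeal_le_one (I : Ideal D) :
    vClosure (I : FractionalIdeal D⁰ (FractionRing D)) ≤ 1 := by
  have h := vClosure_mono (FractionalIdeal.coeIdeal_le_one (P := FractionRing D) (I := I))
  simpa [vClosure] using h

theorem vClosure_coeIdeal_eq_one_iff {I : Ideal D} (hI : I ≠ ⊥) :
    vClosure (I : FractionalIdeal D⁰ (FractionRing D)) = 1 ↔ VMem I 1 := by
  rw [← algebraMap_mem_vClosure_iff hI]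
  constructor
  · intro h
    rw [h]
    simp
  · intro h
    refine le_antisymm (vClosure_coeIdeal_le_one I) ?_
    rw [map_one] at h
    exact FractionalIdeal.one_le.2 h

theorem algebraMap_mem_tClosure_iff {I : Ideal D} (hI : I ≠ ⊥) {x : D} :
    algebraMap D (FractionRing D) x ∈ tClosure (I : FractionalIdeal D⁰ (FractionRing D)) ↔
      TMem I x := by
  have hinj := IsFractionRing.injective D (FractionRing D)
  constructor
  · rintro ⟨H, hfg, hle, hx⟩
    obtain ⟨H, rfl⟩ := FractionalIdeal.le_one_iff_exists_coeIdeal.1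
      (hle.trans FractionalIdeal.coeIdeal_le_one)
    by_cases hH : H = ⊥
    · subst hH
      have : x = 0 := by simpa [vClosure] using hx
      subst this
      exact .of_mem hI I.zero_mem
    · exact ⟨H, (FractionalIdeal.coeIdeal_le_coeIdeal _).1 hle,
        (FractionalIdeal.coeIdeal_fg D⁰ hinj H).1 hfg, hH, (algebraMap_mem_vClosure_iff hH).1 hx⟩
  · rintro ⟨H, hle, hfg, hH, hx⟩
    exact ⟨H, (FractionalIdeal.coeIdeal_fg D⁰ hinj H).2 hfg,
      (FractionalIdeal.coeIdeal_le_coeIdeal _).2 hle, (algebraMap_mem_vClosure_iff hH).2 hx⟩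

theorem IsTSharp.exists_factor (hD : IsTSharp D) {I A B : Ideal D} (hI : I ≠ ⊥) (hA : A ≠ ⊥)
    (hB : B ≠ ⊥) (h : A * B ≤ I) :
    ∃ H J : Ideal D, H ≠ ⊥ ∧ J ≠ ⊥ ∧ (∀ x, TMem I x ↔ TMem (H * J) x) ∧
      (∀ a ∈ A, TMem H a) ∧ ∀ b ∈ B, TMem J b := by
  obtain ⟨H, J, hH, hJ, ht, hAH, hBJ⟩ := hD I A B hI hA hB h
  refine ⟨H, J, hH, hJ, fun x => ?_, fun a ha => ?_, fun b hb => ?_⟩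
  · rw [← algebraMap_mem_tClosure_iff hI, ht, algebraMap_mem_tClosure_iff (mul_ne_zero hH hJ)]
  · exact (algebraMap_mem_tClosure_iff hH).1
      (hAH ((FractionalIdeal.mem_coeIdeal _).2 ⟨a, ha, rfl⟩))
  · exact (algebraMap_mem_tClosure_iff hJ).1
      (hBJ ((FractionalIdeal.mem_coeIdeal _).2 ⟨b, hb, rfl⟩))

/-- Every nonzero ideal `A` has a `v`-inverse of finite type: up to a principal factor,
`(Q A)_v = D` for some finitely generated `Q`. -/
def HasVInverses (D : Type*) [CommRing D] [IsDomain D] : Prop :=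
  ∀ A : Ideal D, A ≠ ⊥ → ∃ (x : D) (Q : Ideal D), x ≠ 0 ∧ Q ≠ ⊥ ∧ Q.FG ∧
    (∀ q ∈ Q, ∀ a ∈ A, x ∣ q * a) ∧ VMem (Q * A) x

theorem IsTSharp.hasVInverses (hD : IsTSharp D) : HasVInverses D := by
  intro A hA
  obtain ⟨x, hxA, hx⟩ := Submodule.exists_mem_ne_zero_of_ne_bot hA
  have hspan : Ideal.span {x} ≠ ⊥ := by simpa using hx
  -- `B = xA⁻¹`, an integral ideal because `x ∈ A`.
  let B : Ideal D :=
    { carrier := {y | ∀ z ∈ A, x ∣ y * z}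
      add_mem' := fun h₁ h₂ z hz => by rw [add_mul]; exact dvd_add (h₁ z hz) (h₂ z hz)
      zero_mem' := fun z _ => by simp
      smul_mem' := fun r y h z hz => by
        rw [smul_eq_mul, mul_assoc]; exact (h z hz).mul_left r }
  have hB : B ≠ ⊥ := by
    intro h
    have : x ∈ B := fun z _ => dvd_mul_right x z
    exact hx (by simpa [h] using this)
  obtain ⟨H, J, hH, hJ, ht, hAH, hBJ⟩ := hD.exists_factor hspan hA hB
    (Ideal.mul_le.2 fun a ha b hb => Ideal.mem_span_singleton.2 (by
      rw [mul_comm]; exact hb a ha))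
  have hdvd : ∀ h ∈ H, ∀ j ∈ J, x ∣ h * j := fun h hh j hj =>
    ((ht _).2 (.of_mem (mul_ne_zero hH hJ) (Ideal.mul_mem_mul hh hj))).dvd hx
  -- That `x` lies in `(HJ)_t` uses finitely many elements, so a finitely generated `Q ⊆ J` already
  -- has `x ∈ (HQ)_v`.
  obtain ⟨E, hE, hEfg, hE0, hv⟩ := (ht x).1 (.of_mem hspan (Ideal.mem_span_singleton_self x))
  obtain ⟨Q, hQJ, hQfg, hEQ⟩ := exists_fg_le_mul_of_fg hEfg hE
  have hQ0 : Q ≠ ⊥ := by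
    rintro rfl
    exact hE0 (by simpa using hEQ)
  refine ⟨x, Q, hx, hQ0, hQfg, fun q hq a ha => ?_, fun b c hc hz => ?_⟩
  · obtain ⟨H₁, hH₁, -, -, hv₁⟩ := hAH a ha
    exact hv₁ q x hx fun z hz => by
      rw [mul_comm]; exact hdvd z (hH₁ hz) q (hQJ hq)
  · refine (hv.mono hEQ) b c hc fun z hzHQ => ?_
    induction hzHQ using Submodule.mul_induction_on' with
    | add z₁ _ z₂ _ h₁ h₂ => rw [mul_add]; exact dvd_add h₁ h₂
    | mem_mul_mem h hh j hj =>
      -- Here `y = (b/c)jx`. As `(b/c)j` sends `A` into `D`, `y ∈ B ⊆ J_t`; then `hJ ⊆ xD` forces `x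
      -- ∣ hy`, that is `c ∣ bhj`.
      obtain ⟨y, hy⟩ := hz (j * x) (Ideal.mul_mem_mul hj hxA)
      have hyB : y ∈ B := by
        intro z hzA
        obtain ⟨m, hm⟩ := hz (j * z) (Ideal.mul_mem_mul hj hzA)
        refine ⟨m, mul_left_cancel₀ hc ?_⟩
        linear_combination z * (-hy) + x * hm
      obtain ⟨J₁, hJ₁, -, -, hv₁⟩ := hBJ y hyB
      obtain ⟨m, hm⟩ := hv₁ h x hx fun z hz => hdvd h hh z (hJ₁ hz)
      refine ⟨m, mul_left_cancel₀ hx ?_⟩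
      linear_combination h * hy + c * hm

/-- `D` is completely integrally closed. -/
theorem HasVInverses.dvd_of_pow_dvd (hD : HasVInverses D) {b c d : D} (hc : c ≠ 0) (hd : d ≠ 0)
    (h : ∀ n : ℕ, c ^ n ∣ d * b ^ n) : c ∣ b := by
  -- `e n = d(b/c)ⁿ`, so multiplication by `b/c` maps the ideal they span into itself.
  choose e he using h
  have he' : ∀ n, b * e n = c * e (n + 1) := by
    intro n
    refine mul_left_cancel₀ (pow_ne_zero n hc) ?_
    linear_combination (he (n + 1)) - b * he n
  have hA : Ideal.span (Set.range e) ≠ ⊥ := by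
    intro h0
    have h1 : e 0 ∈ Ideal.span (Set.range e) := Ideal.subset_span ⟨0, rfl⟩
    have h2 : e 0 = 0 := by simpa [h0] using h1
    exact hd (by simpa [h2] using he 0)
  obtain ⟨x, Q, hx, -, -, hQA, hv⟩ := hD _ hA
  -- `b/c` sends `QA` into `xD`, hence also `x ∈ (QA)_v`; cancelling `x` leaves `b/c ∈ D`.
  have : c * x ∣ b * x := by
    refine hv b (c * x) (mul_ne_zero hc hx) fun z hz => ?_
    induction hz using Submodule.mul_induction_on' with
    | add z₁ _ z₂ _ h₁ h₂ => rw [mul_add]; exact dvd_add h₁ h₂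
    | mem_mul_mem q hq a ha =>
      induction ha using Submodule.span_induction with
      | zero => simp
      | add z₁ z₂ _ _ h₁ h₂ => rw [mul_add, mul_add]; exact dvd_add h₁ h₂
      | smul r z _ h =>
        rw [smul_eq_mul, show b * (q * (r * z)) = r * (b * (q * z)) by ring]
        exact h.mul_left r
      | mem z hz =>
        obtain ⟨n, rfl⟩ := hz
        obtain ⟨m, hm⟩ := hQA q hq (e (n + 1)) (Ideal.subset_span ⟨n + 1, rfl⟩)
        exact ⟨m, by linear_combination q * he' n + c * hm⟩
  exact (mul_dvd_mul_iff_right hx).1 this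

theorem HasVInverses.isIntegrallyClosed (hD : HasVInverses D) : IsIntegrallyClosed D := by
  rw [isIntegrallyClosed_iff (FractionRing D)]
  intro y hy
  obtain ⟨d, hd, h⟩ := hy.isAlmostIntegral
  obtain ⟨b, c, hc, rfl⟩ := IsFractionRing.div_surjective (A := D) y
  have hc0 := nonZeroDivisors.ne_zero hc
  have hc' : algebraMap D (FractionRing D) c ≠ 0 := by simpa using hc0
  obtain ⟨m, hm⟩ := hD.dvd_of_pow_dvd (b := b) hc0 (nonZeroDivisors.ne_zero hd) fun n => by
    obtain ⟨m, hm⟩ := h n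
    refine ⟨m, IsFractionRing.injective D (FractionRing D) ?_⟩
    rw [Algebra.smul_def, div_pow] at hm
    simp only [map_mul, map_pow, hm]
    field_simp
  exact ⟨m, by rw [hm, map_mul]; field_simp⟩

end TSharp

/-! ### The content formula for power series -/

namespace TSharp

/-- A sequence of weights on an initial segment attains its maximum at a least index. -/
theorem exists_least_argmax {Γ : Type*} [LinearOrder Γ] (φ : ℕ → Γ) (L : ℕ) :
    ∃ m ≤ L, (∀ i ≤ L, φ i ≤ φ m) ∧ ∀ i < m, φ i < φ m := by
  classical
  have h : ∃ m, m ≤ L ∧ ∀ i ≤ L, φ i ≤ φ m := by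
    obtain ⟨m, hm, hmax⟩ := Finset.exists_max_image (Finset.range (L + 1)) φ ⟨0, by simp⟩
    exact ⟨m, by simpa [Nat.lt_succ_iff] using hm,
      fun i hi => hmax i (by simpa [Nat.lt_succ_iff] using hi)⟩
  obtain ⟨hL, hmax⟩ := Nat.find_spec h
  refine ⟨Nat.find h, hL, hmax, fun i hi => ?_⟩
  have := Nat.find_min h hi
  push Not at this
  obtain ⟨j, hj, hlt⟩ := this (hi.le.trans hL)
  exact hlt.trans_le (hmax j hj)

/-- Gauss-type inequality for the product of two sequences of elements of valuation at most one:
the weight `v (a i) ^ L * γ ^ i` plays the role of a Gauss norm of radius `γ ^ (1 / L)`. -/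
theorem valuation_mul_pow_le {K Γ : Type*} [Field K] [LinearOrderedCommGroupWithZero Γ]
    (v : Valuation K Γ) (a b : ℕ → K) (ha : ∀ i, v (a i) ≤ 1) (hb : ∀ i, v (b i) ≤ 1)
    {γ : Γ} (hγ : 0 < γ) (hγ1 : γ ≤ 1)
    (h : ∀ n, v (∑ p ∈ Finset.HasAntidiagonal.antidiagonal n, a p.1 * b p.2) ≤ γ) (L : ℕ) {i j : ℕ}
    (hi : i ≤ L) (hj : j ≤ L) : v (a i * b j) ^ L * γ ^ (i + j) ≤ γ ^ L := by
  obtain ⟨m, hm, hmmax, hmlt⟩ := exists_least_argmax (fun i => v (a i) ^ L * γ ^ i) L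
  obtain ⟨n, hn, hnmax, hnlt⟩ := exists_least_argmax (fun i => v (b i) ^ L * γ ^ i) L
  have split : ∀ i j, v (a i * b j) ^ L * γ ^ (i + j) =
      (v (a i) ^ L * γ ^ i) * (v (b j) ^ L * γ ^ j) := by
    intro i j
    rw [map_mul, mul_pow, pow_add, mul_mul_mul_comm]
  have hle : v (a i * b j) ^ L * γ ^ (i + j) ≤ v (a m * b n) ^ L * γ ^ (m + n) := by
    rw [split, split]
    exact mul_le_mul' (hmmax i hi) (hnmax j hj)
  refine hle.trans ?_
  rcases le_or_gt (m + n) L with hmn | hmn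
  -- The index `m + n` is within the range of the maxima, so leastness makes `a m * b n` strictly
  -- dominate the coefficient of that degree.
  · have hv : v (a m * b n) ≤ γ := by
      rcases eq_or_ne (v (a m * b n)) 0 with h0 | h0
      · rw [h0]; exact zero_le
      have hpos : 0 < (v (a m) ^ L * γ ^ m) * (v (b n) ^ L * γ ^ n) := by
        rw [← split]
        exact mul_pos (pow_pos (zero_lt_iff.2 h0) _) (pow_pos hγ _)
      have hposa : 0 < v (a m) ^ L * γ ^ m := zero_lt_iff.2 (left_ne_zero_of_mul hpos.ne')
      have hposb : 0 < v (b n) ^ L * γ ^ n := zero_lt_iff.2 (right_ne_zero_of_mul hpos.ne')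
      refine le_trans (le_of_eq ?_) (h (m + n))
      symm
      refine v.map_sum_eq_of_lt (f := fun p : ℕ × ℕ => a p.1 * b p.2) (j := (m, n))
        (by simp) ?_
      rintro ⟨k, l⟩ hp
      simp only [Finset.mem_sdiff, Finset.HasAntidiagonal.mem_antidiagonal, Finset.mem_singleton,
        Prod.mk.injEq] at hp
      obtain ⟨hkl, hne⟩ := hp
      have hlt : v (a k * b l) ^ L * γ ^ (m + n) < v (a m * b n) ^ L * γ ^ (m + n) := by
        rw [← hkl, split, hkl, split]
        rcases lt_trichotomy k m with hk | hk | hk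
        · exact lt_of_le_of_lt (mul_le_mul_right (hnmax l (by omega)) _)
              (mul_lt_mul_of_pos_right (hmlt k hk) hposb)
        · omega
        · exact lt_of_le_of_lt (mul_le_mul_left (hmmax k (by omega)) _)
              (mul_lt_mul_of_pos_left (hnlt l (by omega)) hposa)
      exact lt_of_pow_lt_pow_left' L (lt_of_mul_lt_mul_right hlt zero_le)
    calc v (a m * b n) ^ L * γ ^ (m + n) ≤ γ ^ L * 1 :=
          mul_le_mul' (pow_le_pow_left' hv L) (pow_le_one' hγ1 _)
      _ = γ ^ L := mul_one _
  -- Beyond the truncation, the weight `γ ^ (m + n)` alone is at most `γ ^ L`.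
  · calc v (a m * b n) ^ L * γ ^ (m + n) ≤ 1 * γ ^ L := by
          refine mul_le_mul' (pow_le_one' ?_ L) (pow_le_pow_right_of_le_one' hγ1 hmn.le)
          rw [map_mul]
          exact mul_le_one' (ha m) (hb n)
      _ = γ ^ L := one_mul _

variable {D : Type*} [CommRing D] [IsDomain D]

/-- An integrally closed domain is the intersection of its valuation overrings. -/
theorem mem_range_of_forall_valuationSubring [IsIntegrallyClosed D] {y : FractionRing D}
    (h : ∀ V : ValuationSubring (FractionRing D),
      (∀ d : D, algebraMap D (FractionRing D) d ∈ V) → y ∈ V) :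
    ∃ d : D, algebraMap D (FractionRing D) d = y := by
  by_contra hy
  let R : Subalgebra D (FractionRing D) := ⊥
  have hcl : IsIntegrallyClosedIn R.toSubring (FractionRing D) := by
    rw [Subring.isIntegrallyClosedIn_iff]
    intro x hx
    have hx' : IsIntegral D x := isIntegral_trans (A := R) x hx
    exact IsIntegrallyClosed.isIntegral_iff.1 hx'
  obtain ⟨V, hV, hyV⟩ := Subring.exists_le_valuationSubring_of_isIntegrallyClosedIn
    (R := R.toSubring) (x := y) fun hy' => hy (Algebra.mem_bot.1 hy')
  exact hyV (h V fun d => hV ⟨d, rfl⟩)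

/-- With `s = f_i g_j`, this says `s^(i+j) ((b/c)s)^n ∈ D` for all `n`. The prefactor does not
depend on `n`, which is what complete integral closure needs in order to conclude `(b/c)s ∈ D`. -/
theorem pow_dvd_of_dvd_coeff_mul [IsIntegrallyClosed D] {f g : PowerSeries D} {b c : D}
    (hc : c ≠ 0) (h : ∀ n, c ∣ b * PowerSeries.coeff n (f * g)) (i j n : ℕ) :
    c ^ n ∣ (PowerSeries.coeff i f * PowerSeries.coeff j g) ^ (i + j) *
      (b * (PowerSeries.coeff i f * PowerSeries.coeff j g)) ^ n := by
  let ι := algebraMap D (FractionRing D)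
  have hc' : ι c ≠ 0 := by simpa [ι] using hc
  obtain ⟨s, hs⟩ : ∃ s, s = PowerSeries.coeff i f * PowerSeries.coeff j g := ⟨_, rfl⟩
  rw [← hs]
  suffices ∃ d : D, ι d = ι s ^ (i + j) * ((ι b / ι c) * ι s) ^ n by
    obtain ⟨d, hd⟩ := this
    refine ⟨d, IsFractionRing.injective D (FractionRing D) ?_⟩
    change ι _ = ι _
    simp only [map_mul, map_pow, hd, mul_pow, div_pow]
    field_simp
  refine mem_range_of_forall_valuationSubring fun V hV => ?_
  let v := V.valuation
  have hv : ∀ d : D, v (ι d) ≤ 1 := fun d => (V.valuation_le_one_iff _).2 (hV d)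
  rw [← V.valuation_le_one_iff]
  change v _ ≤ 1
  rcases le_or_gt (v (ι b / ι c)) 1 with hx | hx
  · simp only [map_mul, map_pow]
    exact mul_le_one' (pow_le_one' (hv s) _) (pow_le_one' (mul_le_one' hx (hv s)) _)
  · have hx0 : 0 < v (ι b / ι c) := zero_lt_one.trans hx
    -- With `γ = v(b/c)⁻¹` and `L = n + (i + j)`, cancelling `γ^(i+j)` leaves `v(s)^(n+i+j) ≤ γ^n`.
    have key := valuation_mul_pow_le v (fun k => ι (PowerSeries.coeff k f))
      (fun k => ι (PowerSeries.coeff k g)) (fun _ => hv _) (fun _ => hv _)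
      (γ := (v (ι b / ι c))⁻¹) (inv_pos.2 hx0) (inv_le_one_of_one_le₀ hx.le)
      (fun k => ?_) (n + (i + j)) (i := i) (j := j) (by omega) (by omega)
    · simp only [← map_mul ι] at key
      rw [← hs, pow_add (v (ι b / ι c))⁻¹ n] at key
      have key' := le_of_mul_le_mul_right key (pow_pos (inv_pos.2 hx0) (i + j))
      rw [pow_add, inv_pow] at key'
      rw [map_mul, map_pow, map_pow, map_mul, mul_pow]
      calc _ = v (ι b / ι c) ^ n * (v (ι s) ^ n * v (ι s) ^ (i + j)) := by
            rw [mul_comm, mul_assoc]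
        _ ≤ v (ι b / ι c) ^ n * (v (ι b / ι c) ^ n)⁻¹ := mul_le_mul_right key' _
        _ = 1 := mul_inv_cancel₀ (pow_pos hx0 n).ne'
    · obtain ⟨e, he⟩ := h k
      have : ∑ p ∈ Finset.HasAntidiagonal.antidiagonal k, ι (PowerSeries.coeff p.1 f) *
          ι (PowerSeries.coeff p.2 g) = ι (PowerSeries.coeff k (f * g)) := by
        simp [PowerSeries.coeff_mul]
      rw [this]
      have he' : (ι b / ι c) * ι (PowerSeries.coeff k (f * g)) = ι e := by
        have := congrArg ι he
        rw [map_mul ι, map_mul ι] at this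
        field_simp
        linear_combination this
      have := hv e
      rw [← he', map_mul] at this
      rwa [← mul_one (v (ι b / ι c))⁻¹, le_inv_mul_iff₀ hx0]

/-- The content formula: a principal fractional ideal that contains the content of a product of
power series contains the product of their contents. -/
theorem HasVInverses.dvd_mul_coeff (hD : HasVInverses D) {f g : PowerSeries D} {b c : D}
    (hc : c ≠ 0) (h : ∀ n, c ∣ b * PowerSeries.coeff n (f * g)) (i j : ℕ) :
    c ∣ b * (PowerSeries.coeff i f * PowerSeries.coeff j g) := by
  have := hD.isIntegrallyClosed
  by_cases h0 : PowerSeries.coeff i f * PowerSeries.coeff j g = 0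
  · simp [h0]
  · exact hD.dvd_of_pow_dvd hc (pow_ne_zero (i + j) h0)
      fun n => pow_dvd_of_dvd_coeff_mul hc h i j n

end TSharp

/-! ### Power series up to unit content -/

namespace TSharp

open Polynomial in
theorem exists_contentIdeal_eq {D : Type*} [CommRing D] {Q : Ideal D} (hQ : Q.FG) :
    ∃ q : D[X], q.contentIdeal = Q := by
  classical
  obtain ⟨n, s, hs⟩ := Submodule.fg_iff_exists_fin_generating_family.1 hQ
  refine ⟨ofFn n s, le_antisymm ?_ ?_⟩
  · rw [contentIdeal_def, Ideal.span_le]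
    intro a ha
    obtain ⟨k, -, rfl⟩ := mem_coeffs_iff.1 (Finset.mem_coe.1 ha)
    rcases lt_or_ge k n with hk | hk
    · rw [ofFn_coeff_eq_val_of_lt s hk, ← hs]
      exact Submodule.subset_span ⟨_, rfl⟩
    · rw [ofFn_coeff_eq_zero_of_ge s hk]
      exact Q.zero_mem
  · rw [← hs, Submodule.span_le]
    rintro _ ⟨k, rfl⟩
    have := coeff_mem_contentIdeal (ofFn n s) k
    rwa [ofFn_coeff_eq_val_of_lt s k.2] at this

theorem forall_mem_content_dvd_iff {D : Type*} [CommRing D] {f : PowerSeries D} {b c : D} :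
    (∀ z ∈ content f, c ∣ b * z) ↔ ∀ n, c ∣ b * PowerSeries.coeff n f := by
  refine ⟨fun h n => h _ (Ideal.subset_span ⟨n, rfl⟩), fun h z hz => ?_⟩
  induction hz using Submodule.span_induction with
  | zero => simp
  | add z₁ z₂ _ _ h₁ h₂ => rw [mul_add]; exact dvd_add h₁ h₂
  | smul r z _ h => rw [smul_eq_mul, mul_left_comm]; exact h.mul_left r
  | mem z hz =>
    obtain ⟨n, rfl⟩ := hz
    exact h n

theorem coeff_mem_content {D : Type*} [CommRing D] (f : PowerSeries D) (n : ℕ) :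
    PowerSeries.coeff n f ∈ content f :=
  Ideal.subset_span ⟨n, rfl⟩

theorem content_ne_bot {D : Type*} [CommRing D] {f : PowerSeries D} (hf : f ≠ 0) :
    content f ≠ ⊥ := by
  intro h
  refine hf (PowerSeries.ext fun n => ?_)
  simpa [h] using coeff_mem_content f n

variable {D : Type*} [CommRing D] [IsDomain D]

theorem mem_Nv'_iff {f : PowerSeries D} : f ∈ Nv' D ↔ f ≠ 0 ∧ VMem (content f) 1 :=
  and_congr_right fun hf => vClosure_coeIdeal_eq_one_iff (content_ne_bot hf)

theorem coe_mem_Nv'_iff {p : Polynomial D} : (p : PowerSeries D) ∈ Nv' D ↔ p ∈ Nv D := by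
  simp only [Nv', Nv, Set.mem_ofPred_eq, content_coe, ne_eq, Polynomial.coe_eq_zero_iff]

theorem one_mem_Nv' : (1 : PowerSeries D) ∈ Nv' D :=
  mem_Nv'_iff.2 ⟨one_ne_zero, .of_mem (by simpa using coeff_mem_content (1 : PowerSeries D) 0)⟩

namespace HasVInverses

/-- The content formula separates the coefficients of `f` and `g`; each unit content is then
cancelled in turn. -/
theorem mul_mem_Nv' (hD : HasVInverses D) {f g : PowerSeries D} (hf : f ∈ Nv' D)
    (hg : g ∈ Nv' D) : f * g ∈ Nv' D := by
  rw [mem_Nv'_iff] at *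
  refine ⟨mul_ne_zero hf.1 hg.1, fun b c hc h => ?_⟩
  rw [forall_mem_content_dvd_iff] at h
  refine hf.2 b c hc (forall_mem_content_dvd_iff.2 fun i => ?_)
  have := hg.2 (b * PowerSeries.coeff i f) c hc (forall_mem_content_dvd_iff.2 fun j => by
    rw [mul_assoc]; exact hD.dvd_mul_coeff hc h i j)
  rwa [mul_one] at this

theorem coe_closure_Nv' (hD : HasVInverses D) :
    (Submonoid.closure (Nv' D) : Set (PowerSeries D)) = Nv' D :=
  congrArg SetLike.coe (Submonoid.closure_eq
    { carrier := Nv' D, one_mem' := one_mem_Nv', mul_mem' := hD.mul_mem_Nv' })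

theorem coe_closure_Nv (hD : HasVInverses D) :
    (Submonoid.closure (Nv D) : Set (Polynomial D)) = Nv D :=
  congrArg SetLike.coe (Submonoid.closure_eq
    { carrier := Nv D
      one_mem' := coe_mem_Nv'_iff.1 (by simpa using one_mem_Nv')
      mul_mem' := fun ha hb => coe_mem_Nv'_iff.1 (by
        rw [Polynomial.coe_mul]
        exact hD.mul_mem_Nv' (coe_mem_Nv'_iff.2 ha) (coe_mem_Nv'_iff.2 hb)) })

theorem mem_closure_Nv'_iff (hD : HasVInverses D) {f : PowerSeries D} :
    f ∈ Submonoid.closure (Nv' D) ↔ f ∈ Nv' D := by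
  rw [← SetLike.mem_coe, hD.coe_closure_Nv']

theorem mem_closure_Nv_iff (hD : HasVInverses D) {p : Polynomial D} :
    p ∈ Submonoid.closure (Nv D) ↔ p ∈ Nv D := by
  rw [← SetLike.mem_coe, hD.coe_closure_Nv]

/-- Every nonzero power series has a polynomial multiple whose content has principal
`v`-closure. -/
theorem exists_mul_coe_eq_C_mul (hD : HasVInverses D) {f : PowerSeries D} (hf : f ≠ 0) :
    ∃ (q : Polynomial D) (x : D) (u : PowerSeries D), q ≠ 0 ∧ x ≠ 0 ∧ u ∈ Nv' D ∧
      f * q = PowerSeries.C x * u := by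
  obtain ⟨x, Q, hx, hQ, hQfg, hdvd, hv⟩ := hD _ (content_ne_bot hf)
  obtain ⟨q, rfl⟩ := exists_contentIdeal_eq hQfg
  have hq : q ≠ 0 := by rwa [ne_eq, Polynomial.contentIdeal_eq_bot_iff] at hQ
  have hcoeff : ∀ n, x ∣ PowerSeries.coeff n (f * q) := by
    intro n
    rw [PowerSeries.coeff_mul]
    refine Finset.dvd_sum fun p _ => ?_
    rw [Polynomial.coeff_coe, mul_comm]
    exact hdvd _ (q.coeff_mem_contentIdeal _) _ (coeff_mem_content f _)
  choose u hu using hcoeff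
  have hfu : f * q = PowerSeries.C x * PowerSeries.mk u := by
    ext n
    rw [hu, PowerSeries.coeff_C_mul, PowerSeries.coeff_mk]
  refine ⟨q, x, PowerSeries.mk u, hq, hx, mem_Nv'_iff.2 ⟨?_, fun b c hc h => ?_⟩, hfu⟩
  · intro h0
    rw [h0, mul_zero] at hfu
    exact mul_ne_zero hf (by simpa using hq) hfu
  · rw [forall_mem_content_dvd_iff] at h
    have hcx : ∀ n, c * x ∣ b * PowerSeries.coeff n (f * (q : PowerSeries D)) := by
      intro n
      obtain ⟨m, hm⟩ := h n
      rw [PowerSeries.coeff_mk] at hm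
      exact ⟨m, by rw [hu]; linear_combination x * hm⟩
    -- The content formula passes from `c(fq)` to `c(f)c(q)`, whose `v`-closure contains `x`.
    have hprod := hD.dvd_mul_coeff (mul_ne_zero hc hx) hcx
    rw [mul_one]
    refine (mul_dvd_mul_iff_right hx).1 (hv b (c * x) (mul_ne_zero hc hx) fun z hz => ?_)
    induction hz using Submodule.mul_induction_on' with
    | add z₁ _ z₂ _ h₁ h₂ => rw [mul_add]; exact dvd_add h₁ h₂
    | mem_mul_mem m hm a ha =>
      rw [← mul_assoc]
      refine forall_mem_content_dvd_iff.2 (fun i => ?_) a ha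
      rw [mul_right_comm]
      rw [← content_coe] at hm
      refine forall_mem_content_dvd_iff.2 (fun j => ?_) m hm
      rw [mul_assoc]
      exact hprod i j

/-- For polynomial input the cofactor `u` is itself a polynomial, being `p * q` divided by a
constant. -/
theorem exists_mul_eq_C_mul (hD : HasVInverses D) {p : Polynomial D} (hp : p ≠ 0) :
    ∃ (q : Polynomial D) (x : D) (w : Polynomial D), q ≠ 0 ∧ x ≠ 0 ∧ w ∈ Nv D ∧
      p * q = Polynomial.C x * w := by
  obtain ⟨q, x, u, hq, hx, hu, h⟩ := hD.exists_mul_coe_eq_C_mul (f := p) (by simpa using hp)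
  obtain ⟨w, hw⟩ := (Polynomial.C_dvd_iff_dvd_coeff x (p * q)).2 fun n => by
    rw [← Polynomial.coeff_coe, Polynomial.coe_mul, h, PowerSeries.coeff_C_mul]
    exact dvd_mul_right _ _
  refine ⟨q, x, w, hq, hx, coe_mem_Nv'_iff.1 ?_, hw⟩
  have hx' : PowerSeries.C x ≠ 0 := (map_ne_zero_iff _ PowerSeries.C_injective).2 hx
  have : (w : PowerSeries D) = u := by
    refine mul_left_cancel₀ hx' ?_
    rw [← h, ← Polynomial.coe_C, ← Polynomial.coe_mul, ← hw, Polynomial.coe_mul]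
  rwa [this]

/-- Up to elements of `N_v` and `N'_v` every power series is a polynomial. -/
theorem exists_mul_eq_mul_coe (hD : HasVInverses D) (f : PowerSeries D) :
    ∃ (w p : Polynomial D) (u : PowerSeries D), w ∈ Nv D ∧ u ∈ Nv' D ∧ w * f = u * p := by
  by_cases hf : f = 0
  · exact ⟨1, 0, 1, coe_mem_Nv'_iff.1 (by simpa using one_mem_Nv'), one_mem_Nv', by simp [hf]⟩
  obtain ⟨q, x, u, hq, hx, hu, hfq⟩ := hD.exists_mul_coe_eq_C_mul hf
  obtain ⟨p, y, w, hp, hy, hw, hqp⟩ := hD.exists_mul_eq_C_mul hq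
  have hqp' : (q : PowerSeries D) * p = PowerSeries.C y * w := by
    rw [← Polynomial.coe_mul, hqp, Polynomial.coe_mul, Polynomial.coe_C]
  have hmain : PowerSeries.C x * (u * p) = PowerSeries.C y * (w * f) := by
    linear_combination f * hqp' - p * hfq
  -- By `hmain`, `y` divides the coefficients of `x * u * p`; the content formula and the unit
  -- content of `u` give `y ∣ x * p`.
  obtain ⟨p', hp'⟩ := (Polynomial.C_dvd_iff_dvd_coeff y (Polynomial.C x * p)).2 fun j => by
    have h := (mem_Nv'_iff.1 hu).2 (x * p.coeff j) y hy (forall_mem_content_dvd_iff.2 fun i => by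
      have := hD.dvd_mul_coeff (f := u) (g := p) (b := x) hy (fun n => by
        rw [← PowerSeries.coeff_C_mul, hmain, PowerSeries.coeff_C_mul]
        exact dvd_mul_right _ _) i j
      rwa [Polynomial.coeff_coe, mul_comm (PowerSeries.coeff i u), ← mul_assoc] at this)
    rwa [mul_one, ← Polynomial.coeff_C_mul] at h
  have hpy : PowerSeries.C x * p = PowerSeries.C y * (p' : PowerSeries D) := by
    rw [← Polynomial.coe_C, ← Polynomial.coe_mul, hp', Polynomial.coe_mul, Polynomial.coe_C]
  refine ⟨w, p', u, hw, hu, ?_⟩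
  have hy' : PowerSeries.C y ≠ 0 := (map_ne_zero_iff _ PowerSeries.C_injective).2 hy
  refine mul_left_cancel₀ hy' ?_
  linear_combination u * hpy - hmain

/-- Up to elements of `N_v`, a polynomial divides the `v`-closure of its content. -/
theorem exists_C_mul_eq_mul (hD : HasVInverses D) {p : Polynomial D} (hp : p ≠ 0) {a : D}
    (ha : VMem p.contentIdeal a) :
    ∃ w ∈ Nv D, ∃ r : Polynomial D, Polynomial.C a * w = p * r := by
  obtain ⟨q, x, w, hq, hx, hw, hpq⟩ := hD.exists_mul_eq_C_mul hp
  -- `x` divides every `p_i q_j`, hence every `a q_j`, because `a ∈ c(p)_v`.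
  obtain ⟨r, hr⟩ := (Polynomial.C_dvd_iff_dvd_coeff x (Polynomial.C a * q)).2 fun j => by
    rw [Polynomial.coeff_C_mul, mul_comm]
    rw [← content_coe] at ha
    refine ha _ x hx (forall_mem_content_dvd_iff.2 fun i => ?_)
    have := hD.dvd_mul_coeff (f := p) (g := q) (b := 1) hx (fun n => by
      rw [← Polynomial.coe_mul, hpq, Polynomial.coeff_coe, Polynomial.coeff_C_mul, one_mul]
      exact dvd_mul_right _ _) i j
    rwa [one_mul, Polynomial.coeff_coe q, mul_comm] at this
  have hx' : Polynomial.C x ≠ 0 := by simpa using hx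
  refine ⟨w, hw, r, mul_left_cancel₀ hx' ?_⟩
  linear_combination p * hr - Polynomial.C a * hpq

end HasVInverses

end TSharp

/-! ### The localizations -/

namespace TSharp

open Polynomial in
theorem map_mem_map_contentIdeal {D T : Type*} [CommRing D] [CommRing T] (φ : D[X] →+* T)
    (p : D[X]) : φ p ∈ p.contentIdeal.map (φ.comp C) := by
  rw [p.as_sum_range_C_mul_X_pow, map_sum, ← p.as_sum_range_C_mul_X_pow]
  refine Ideal.sum_mem _ fun i _ => ?_
  rw [map_mul]
  exact Ideal.mul_mem_right _ _
    (Ideal.mem_map_of_mem (φ.comp C) (p.coeff_mem_contentIdeal i))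

theorem content_le_of_mem_map {D : Type*} [CommRing D] {A : Ideal D} {f : PowerSeries D}
    (hf : f ∈ A.map (algebraMap D (PowerSeries D))) : content f ≤ A := by
  rw [content, Ideal.span_le]
  rintro _ ⟨n, rfl⟩
  induction hf using Submodule.span_induction generalizing n with
  | zero => simp
  | add x y _ _ hx hy => simpa using A.add_mem (hx n) (hy n)
  | smul g x _ hx =>
    simp only [smul_eq_mul, PowerSeries.coeff_mul]
    exact Ideal.sum_mem _ fun p _ => A.mul_mem_left _ (hx p.2)
  | mem x hx =>
    obtain ⟨a, ha, rfl⟩ := hx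
    simp only [PowerSeries.algebraMap_apply, Algebra.algebraMap_self, RingHom.id_apply,
      PowerSeries.coeff_C]
    split_ifs
    · exact ha
    · exact A.zero_mem

theorem exists_fg_le_mem_map {R S : Type*} [CommRing R] [CommRing S] (φ : R →+* S) {A : Ideal R}
    {f : S} (hf : f ∈ A.map φ) : ∃ A₀ ≤ A, A₀.FG ∧ f ∈ A₀.map φ := by
  induction hf using Submodule.span_induction with
  | zero => exact ⟨⊥, bot_le, Submodule.fg_bot, Ideal.zero_mem _⟩
  | add x y _ _ hx hy =>
    obtain ⟨J₁, h₁, f₁, m₁⟩ := hx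
    obtain ⟨J₂, h₂, f₂, m₂⟩ := hy
    exact ⟨J₁ ⊔ J₂, sup_le h₁ h₂, Submodule.FG.sup f₁ f₂,
      add_mem (Ideal.map_mono le_sup_left m₁) (Ideal.map_mono le_sup_right m₂)⟩
  | smul g x _ hx =>
    obtain ⟨J₁, h₁, f₁, m₁⟩ := hx
    exact ⟨J₁, h₁, f₁, Ideal.mul_mem_left _ _ m₁⟩
  | mem x hx =>
    obtain ⟨a, ha, rfl⟩ := hx
    exact ⟨Ideal.span {a}, (Ideal.span_singleton_le_iff_mem _).2 ha, ⟨{a}, by simp⟩,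
      Ideal.mem_map_of_mem _ (Ideal.mem_span_singleton_self a)⟩

/-- Over a Bezout domain flat means torsion-free, which holds for any domain extension. -/
theorem flat_of_injective_of_isBezout {A B : Type*} [CommRing A] [IsDomain A] [IsBezout A]
    [CommRing B] [IsDomain B] {φ : A →+* B} (hφ : Function.Injective φ) : φ.Flat := by
  algebraize [φ]
  have : FaithfulSMul A B := (faithfulSMul_iff_algebraMap_injective A B).2 hφ
  change Module.Flat A B
  rw [Module.Flat.flat_iff_torsion_eq_bot_of_isBezout,
    ← Submodule.isTorsionFree_iff_torsion_eq_bot]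
  infer_instance

variable {D : Type*} [CommRing D] [IsDomain D]

/-- The composite `D[X] → D[[X]] → D[[X]]_{N'_v}`. -/
noncomputable def polyToPowerLoc (D : Type*) [CommRing D] [IsDomain D] :
    Polynomial D →+* PowerLoc D :=
  (algebraMap (PowerSeries D) (PowerLoc D)).comp Polynomial.coeToPowerSeries.ringHom

theorem polyToPowerLoc_comp_C :
    (polyToPowerLoc D).comp Polynomial.C = algebraMap D (PowerLoc D) := by
  ext a
  simp only [polyToPowerLoc, RingHom.comp_apply, Polynomial.coeToPowerSeries.ringHom_apply,
    Polynomial.coe_C]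
  rw [IsScalarTower.algebraMap_apply D (PowerSeries D) (PowerLoc D)]
  simp

theorem algebraMap_comp_C :
    (algebraMap (Polynomial D) (PolyLoc D)).comp Polynomial.C = algebraMap D (PolyLoc D) := by
  rw [IsScalarTower.algebraMap_eq D (Polynomial D) (PolyLoc D), Polynomial.algebraMap_eq]

theorem polyToPower_comp_algebraMap :
    (polyToPower D).comp (algebraMap (Polynomial D) (PolyLoc D)) = polyToPowerLoc D :=
  IsLocalization.map_comp _

theorem polyToPower_comp_algebraMap_base :
    (polyToPower D).comp (algebraMap D (PolyLoc D)) = algebraMap D (PowerLoc D) := by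
  rw [← algebraMap_comp_C, ← RingHom.comp_assoc, polyToPower_comp_algebraMap,
    polyToPowerLoc_comp_C]

theorem isUnit_algebraMap_of_mem_Nv {w : Polynomial D} (hw : w ∈ Nv D) :
    IsUnit (algebraMap (Polynomial D) (PolyLoc D) w) :=
  IsLocalization.map_units (M := Submonoid.closure (Nv D)) (PolyLoc D)
    ⟨w, Submonoid.subset_closure hw⟩

theorem isUnit_algebraMap_of_mem_Nv' {u : PowerSeries D} (hu : u ∈ Nv' D) :
    IsUnit (algebraMap (PowerSeries D) (PowerLoc D) u) :=
  IsLocalization.map_units (M := Submonoid.closure (Nv' D)) (PowerLoc D)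
    ⟨u, Submonoid.subset_closure hu⟩

theorem isUnit_polyToPowerLoc_of_mem_Nv {w : Polynomial D} (hw : w ∈ Nv D) :
    IsUnit (polyToPowerLoc D w) :=
  isUnit_algebraMap_of_mem_Nv' (coe_mem_Nv'_iff.2 hw)

namespace HasVInverses

section

variable {T : Type*} [CommRing T] {φ : Polynomial D →+* T}

/-- An arbitrary `φ` inverting `N_v` covers both localizations at once. -/
theorem map_dvd_of_vMem (hD : HasVInverses D) (hφ : ∀ w ∈ Nv D, IsUnit (φ w))
    {p : Polynomial D} (hp : p ≠ 0) {a : D} (ha : VMem p.contentIdeal a) :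
    φ p ∣ φ (Polynomial.C a) := by
  obtain ⟨w, hw, r, h⟩ := hD.exists_C_mul_eq_mul hp ha
  rw [← (hφ w hw).dvd_mul_right, ← map_mul, h, map_mul]
  exact dvd_mul_right _ _

theorem map_dvd_of_mem_contentIdeal (hD : HasVInverses D) (hφ : ∀ w ∈ Nv D, IsUnit (φ w))
    {p : Polynomial D} {a : D} (ha : a ∈ p.contentIdeal) : φ p ∣ φ (Polynomial.C a) := by
  by_cases hp : p = 0
  · subst hp
    have : a = 0 := by simpa using ha
    simp [this]
  · exact hD.map_dvd_of_vMem hφ hp (.of_mem ha)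

theorem map_contentIdeal_eq (hD : HasVInverses D) (hφ : ∀ w ∈ Nv D, IsUnit (φ w))
    (p : Polynomial D) : p.contentIdeal.map (φ.comp Polynomial.C) = Ideal.span {φ p} := by
  refine le_antisymm ?_ ((Ideal.span_singleton_le_iff_mem _).2 (map_mem_map_contentIdeal φ p))
  rw [Ideal.map_le_iff_le_comap]
  exact fun a ha => Ideal.mem_span_singleton.2 (hD.map_dvd_of_mem_contentIdeal hφ ha)

/-- Extension does not see t-closure: finitely generated ideals are contents of polynomials, and `φ
p` divides everything in the `v`-closure of the content. -/
theorem mem_map_of_tMem (hD : HasVInverses D) (hφ : ∀ w ∈ Nv D, IsUnit (φ w)) {I : Ideal D}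
    {a : D} (ha : TMem I a) : φ (Polynomial.C a) ∈ I.map (φ.comp Polynomial.C) := by
  obtain ⟨H, hHI, hfg, hH, hv⟩ := ha
  obtain ⟨p, rfl⟩ := exists_contentIdeal_eq hfg
  have hp : p ≠ 0 := by rwa [ne_eq, Polynomial.contentIdeal_eq_bot_iff] at hH
  exact Ideal.mem_of_dvd _ (hD.map_dvd_of_vMem hφ hp hv)
    (Ideal.map_mono hHI (map_mem_map_contentIdeal φ p))

theorem mem_map_comap_of_mem (hD : HasVInverses D) (hφ : ∀ w ∈ Nv D, IsUnit (φ w)) {J : Ideal T}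
    {p : Polynomial D} (hp : φ p ∈ J) :
    φ p ∈ (J.comap (φ.comp Polynomial.C)).map (φ.comp Polynomial.C) := by
  refine Ideal.map_mono ?_ (map_mem_map_contentIdeal φ p)
  rw [← Ideal.map_le_iff_le_comap, hD.map_contentIdeal_eq hφ]
  exact (Ideal.span_singleton_le_iff_mem _).2 hp

end

theorem map_comap_polyLoc (hD : HasVInverses D) (J : Ideal (PolyLoc D)) :
    (J.comap (algebraMap D (PolyLoc D))).map (algebraMap D (PolyLoc D)) = J := by
  refine le_antisymm Ideal.map_comap_le fun z hz => ?_
  obtain ⟨⟨p, w⟩, h⟩ := IsLocalization.surj (Submonoid.closure (Nv D)) z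
  have hw := IsLocalization.map_units (PolyLoc D) w
  rw [← Ideal.mul_unit_mem_iff_mem _ hw, h, ← algebraMap_comp_C]
  refine hD.mem_map_comap_of_mem (fun w hw => isUnit_algebraMap_of_mem_Nv hw) ?_
  rw [← h]
  exact J.mul_mem_right _ hz

/-- Up to units every element is the image of a polynomial, and a polynomial generates the same
ideal as its content. -/
theorem map_comap_powerLoc (hD : HasVInverses D) (J : Ideal (PowerLoc D)) :
    (J.comap (algebraMap D (PowerLoc D))).map (algebraMap D (PowerLoc D)) = J := by
  refine le_antisymm Ideal.map_comap_le fun z hz => ?_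
  obtain ⟨⟨f, n⟩, h⟩ := IsLocalization.surj (Submonoid.closure (Nv' D)) z
  have hn := IsLocalization.map_units (PowerLoc D) n
  obtain ⟨w, p, u, hw, hu, hwf⟩ := hD.exists_mul_eq_mul_coe f
  have hw' := isUnit_polyToPowerLoc_of_mem_Nv hw
  have hu' := isUnit_algebraMap_of_mem_Nv' hu
  have hp : polyToPowerLoc D w * algebraMap _ (PowerLoc D) f =
      algebraMap _ (PowerLoc D) u * polyToPowerLoc D p := by
    simpa [polyToPowerLoc] using congrArg (algebraMap (PowerSeries D) (PowerLoc D)) hwf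
  rw [← Ideal.mul_unit_mem_iff_mem _ hn, h, ← Ideal.unit_mul_mem_iff_mem _ hw', hp,
    Ideal.unit_mul_mem_iff_mem _ hu', ← polyToPowerLoc_comp_C]
  refine hD.mem_map_comap_of_mem (fun w hw => isUnit_polyToPowerLoc_of_mem_Nv hw) ?_
  rw [← Ideal.unit_mul_mem_iff_mem _ hu', ← hp, ← h]
  exact J.mul_mem_left _ (J.mul_mem_right _ hz)

theorem isDomain_powerLoc (hD : HasVInverses D) : IsDomain (PowerLoc D) :=
  IsLocalization.isDomain_of_le_nonZeroDivisors (PowerLoc D) (M := Submonoid.closure (Nv' D))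
    fun _ hf => mem_nonZeroDivisors_of_ne_zero (hD.mem_closure_Nv'_iff.1 hf).1

theorem isDomain_polyLoc (hD : HasVInverses D) : IsDomain (PolyLoc D) :=
  IsLocalization.isDomain_of_le_nonZeroDivisors (PolyLoc D) (M := Submonoid.closure (Nv D))
    fun _ hf => mem_nonZeroDivisors_of_ne_zero (hD.mem_closure_Nv_iff.1 hf).1

/-- A finitely generated ideal is extended from a finitely generated ideal of `D`; a polynomial with
that content generates it. -/
theorem isBezout_polyLoc (hD : HasVInverses D) : IsBezout (PolyLoc D) := by
  rw [IsBezout.iff_span_pair_isPrincipal]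
  intro x y
  have hmap := hD.map_comap_polyLoc (Ideal.span {x, y})
  have hx : x ∈ Ideal.span {x, y} := Ideal.subset_span (by simp)
  have hy : y ∈ Ideal.span {x, y} := Ideal.subset_span (by simp)
  obtain ⟨A, hA, hAfg, hxA⟩ := exists_fg_le_mem_map _ (hmap.ge hx)
  obtain ⟨B, hB, hBfg, hyB⟩ := exists_fg_le_mem_map _ (hmap.ge hy)
  obtain ⟨p, hp⟩ := exists_contentIdeal_eq (Submodule.FG.sup hAfg hBfg)
  have hspan : Ideal.span {x, y} = (A ⊔ B).map (algebraMap D (PolyLoc D)) := by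
    refine le_antisymm ?_ ((Ideal.map_mono (sup_le hA hB)).trans hmap.le)
    rw [Ideal.span_le]
    rintro z (rfl | rfl)
    · exact Ideal.map_mono le_sup_left hxA
    · exact Ideal.map_mono le_sup_right hyB
  refine ⟨algebraMap (Polynomial D) (PolyLoc D) p, ?_⟩
  rw [hspan, ← hp, ← algebraMap_comp_C]
  exact hD.map_contentIdeal_eq (fun w hw => isUnit_algebraMap_of_mem_Nv hw) p

theorem polyToPower_injective (hD : HasVInverses D) : Function.Injective (polyToPower D) := by
  rw [injective_iff_map_eq_zero]
  intro z hz
  obtain ⟨⟨p, w⟩, h⟩ := IsLocalization.surj (Submonoid.closure (Nv D)) z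
  have hw := IsLocalization.map_units (PolyLoc D) w
  have hp : polyToPowerLoc D p = 0 := by
    rw [← polyToPower_comp_algebraMap, RingHom.comp_apply, ← h, map_mul, hz, zero_mul]
  have hle : Submonoid.closure (Nv' D) ≤ (PowerSeries D)⁰ :=
    fun _ hf => mem_nonZeroDivisors_of_ne_zero (hD.mem_closure_Nv'_iff.1 hf).1
  have hp0 : p = 0 := by
    have := (IsLocalization.to_map_eq_zero_iff (PowerLoc D) hle).1 hp
    simpa using this
  simp only [hp0, map_zero] at h
  exact hw.mul_left_eq_zero.1 h

/-- Some `f ∈ N'_v` lies in `A D[[X]]`. Only finitely many elements of `A` are involved, so `c(f)`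
lies in a finitely generated `A₀ ⊆ A`, whence `1 ∈ (A₀)_v`. -/
theorem one_tMem_of_map_eq_top (hD : HasVInverses D) {A : Ideal D}
    (h : A.map (algebraMap D (PowerLoc D)) = ⊤) : TMem A 1 := by
  have h1 : (1 : PowerLoc D) ∈ (A.map (algebraMap D (PowerSeries D))).map
      (algebraMap (PowerSeries D) (PowerLoc D)) := by
    rw [Ideal.map_map, ← IsScalarTower.algebraMap_eq, h]
    trivial
  obtain ⟨⟨⟨f, hf⟩, u⟩, hfu⟩ :=
    (IsLocalization.mem_map_algebraMap_iff (Submonoid.closure (Nv' D)) (PowerLoc D)).1 h1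
  have hle : Submonoid.closure (Nv' D) ≤ (PowerSeries D)⁰ :=
    fun _ hf => mem_nonZeroDivisors_of_ne_zero (hD.mem_closure_Nv'_iff.1 hf).1
  rw [one_mul] at hfu
  have hu : (u : PowerSeries D) = f := IsLocalization.injective (PowerLoc D) hle hfu
  obtain ⟨hf0, hv⟩ := mem_Nv'_iff.1 (hD.mem_closure_Nv'_iff.1 (hu ▸ u.2 : f ∈ _))
  obtain ⟨A₀, hA₀, hfg, hfA₀⟩ := exists_fg_le_mem_map _ hf
  have hc := content_le_of_mem_map hfA₀
  exact ⟨A₀, hA₀, hfg, fun h0 => content_ne_bot hf0 (le_bot_iff.1 (h0 ▸ hc)), hv.mono hc⟩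

theorem faithfullyFlat_polyToPower (hD : HasVInverses D) : (polyToPower D).FaithfullyFlat := by
  algebraize [polyToPower D]
  rw [← RingHom.algebraMap_toAlgebra (polyToPower D), RingHom.faithfullyFlat_algebraMap_iff,
    Module.FaithfullyFlat.iff_flat_and_ideal_smul_eq_top]
  have := hD.isDomain_powerLoc
  have := hD.isDomain_polyLoc
  have := hD.isBezout_polyLoc
  constructor
  · exact RingHom.flat_algebraMap_iff.1 (flat_of_injective_of_isBezout hD.polyToPower_injective)
  · intro I hI
    rw [Ideal.smul_top_eq_map] at hI
    have hI' : I.map (polyToPower D) = ⊤ := (Submodule.restrictScalars_eq_top_iff _ _ _).1 hI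
    -- Properness is tested on the contraction to `D`: if it extends to the unit ideal upstairs, its
    -- t-closure contains `1`, so it does so in `PolyLoc D` too.
    rw [← hD.map_comap_polyLoc I] at hI' ⊢
    rw [Ideal.map_map, polyToPower_comp_algebraMap_base] at hI'
    have := hD.mem_map_of_tMem (φ := algebraMap (Polynomial D) (PolyLoc D))
      (fun w hw => isUnit_algebraMap_of_mem_Nv hw) (hD.one_tMem_of_map_eq_top hI')
    rw [algebraMap_comp_C, map_one, map_one] at this
    exact (Ideal.eq_top_iff_one _).2 this

theorem bijective_map_polyToPower (hD : HasVInverses D) :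
    Function.Bijective (fun I : Ideal (PolyLoc D) => I.map (polyToPower D)) := by
  constructor
  · have h := hD.faithfullyFlat_polyToPower
    algebraize [polyToPower D]
    exact Ideal.map_injective_of_faithfullyFlat (A := PolyLoc D) (B := PowerLoc D)
  · intro J
    refine ⟨(J.comap (algebraMap D (PowerLoc D))).map (algebraMap D (PolyLoc D)), ?_⟩
    change Ideal.map _ _ = _
    rw [Ideal.map_map, polyToPower_comp_algebraMap_base, hD.map_comap_powerLoc]

end HasVInverses

/-- Contract to `D`, factor there by t-sharpness, and extend back: the t-closures disappear and
contracted ideals return to themselves. -/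
theorem IsTSharp.isSharp_powerLoc (hD : IsTSharp D) : IsSharp (PowerLoc D) := by
  have hV := hD.hasVInverses
  intro I A B hI hA hB hAB
  have hmap := hV.map_comap_powerLoc
  have hne : ∀ J : Ideal (PowerLoc D), J ≠ ⊥ → J.comap (algebraMap D (PowerLoc D)) ≠ ⊥ := by
    intro J hJ h
    exact hJ (by rw [← hmap J, h, Ideal.map_bot])
  have ht : ∀ {J : Ideal D} {a : D}, TMem J a →
      algebraMap D (PowerLoc D) a ∈ J.map (algebraMap D (PowerLoc D)) := by
    intro J a ha
    have := hV.mem_map_of_tMem (fun w hw => isUnit_polyToPowerLoc_of_mem_Nv hw) ha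
    rwa [← RingHom.comp_apply, polyToPowerLoc_comp_C] at this
  obtain ⟨H, J, hH, hJ, hIHJ, hAH, hBJ⟩ := hD.exists_factor (hne I hI) (hne A hA) (hne B hB)
    (Ideal.mul_le.2 fun a ha b hb => by
      rw [Ideal.mem_comap, map_mul]
      exact hAB (Ideal.mul_mem_mul ha hb))
  refine ⟨H.map (algebraMap D (PowerLoc D)), J.map (algebraMap D (PowerLoc D)), ?_, ?_, ?_⟩
  · rw [← Ideal.map_mul]
    nth_rw 1 [← hmap I]
    apply le_antisymm <;> rw [Ideal.map_le_iff_le_comap] <;> intro x hx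
    · exact ht ((hIHJ x).1 (.of_mem (hne I hI) hx))
    · exact ht ((hIHJ x).2 (.of_mem (mul_ne_zero hH hJ) hx))
  · rw [← hmap A, Ideal.map_le_iff_le_comap]
    exact fun a ha => ht (hAH a ha)
  · rw [← hmap B, Ideal.map_le_iff_le_comap]
    exact fun b hb => ht (hBJ b hb)

end TSharp

theorem mainTheorem12 (D : Type*) [CommRing D] [IsDomain D] (hD : TSharp.IsTSharp D) :
    -- `N'_v` and `N_v` are multiplicative sets
    (Submonoid.closure (TSharp.Nv' D) : Set (PowerSeries D)) = TSharp.Nv' D ∧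
    (Submonoid.closure (TSharp.Nv D) : Set (Polynomial D)) = TSharp.Nv D ∧
    -- `D[[X]]_{N'_v}` is a sharp domain
    IsDomain (TSharp.PowerLoc D) ∧
    TSharp.IsSharp (TSharp.PowerLoc D) ∧
    -- every ideal of `D[[X]]_{N'_v}` is extended from `D`
    (∀ J : Ideal (TSharp.PowerLoc D), ∃ I : Ideal D,
      J = I.map (algebraMap D (TSharp.PowerLoc D))) ∧
    -- `D[[X]]_{N'_v}` is faithfully flat over `D[X]_{N_v}`
    (TSharp.polyToPower D).FaithfullyFlat ∧
    -- extension is a bijection between the ideals of the two rings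
    Function.Bijective (fun I : Ideal (TSharp.PolyLoc D) => I.map (TSharp.polyToPower D)) := by
  have hV := hD.hasVInverses
  exact ⟨hV.coe_closure_Nv', hV.coe_closure_Nv, hV.isDomain_powerLoc, hD.isSharp_powerLoc,
    fun J => ⟨_, (hV.map_comap_powerLoc J).symm⟩, hV.faithfullyFlat_polyToPower,
    hV.bijective_map_polyToPower⟩
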